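/- Let $R$ be a commutative ring with identity and let $S$ be a multiplicative subset of $R$, that is, a nonempty subset closed under multiplication. For $n\in\mathbb N=\{1,2,\dots\}$, an ideal $I$ of $R$ disjoint from $S$ is called $S$-$n$-absorbing if there is $s\in S$ such that for all $r_1,\dots,r_{n+1}\in R$ with $r_1\cdots r_{n+1}\in I$ there is $1\le j\le n+1$ with $s\prod_{i\ne j} r_i\in I$. For an ideal $I$ disjoint from $S$, let $\omega_{R,S}(I)$ be the least $n\in\mathbb N$ such that $I$ is $S$-$n$-absorbing, and $\omega_{R,S}(I)=\infty$ if there is no such $n$. Put $\Omega_S(R)=\{\omega_{R,S}(I) : I \text{ an ideal of } R \text{ disjoint from } S\}$; thus $\Omega_S(R)\subseteq\mathbb N$ means that every ideal disjoint from $S$ is $S$-$n$-absorbing for some $n\in\mathbb N$. An ideal $I$ disjoint from $S$ is $S$-primary if there is $s\in S$ such that $ab\in I$ ($a,b\in R$) implies $sa\in I$ or $sb\in\sqrt I$; it is strongly $S$-primary if moreover $t(\sqrt I)^n\subseteq I$ for some $n\in\mathbb N$ and $t\in S$. The ring $R$ is strongly $S$-Laskerian if every ideal of $R$ disjoint from $S$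 is an intersection of finitely many strongly $S$-primary ideals. The ring $R$ is $S$-Noetherian if for every ideal $I$ there are $s\in S$ and a finitely generated ideal $J$ with $sI\subseteq J\subseteq I$. A ring is divided if for every prime ideal $P$ and every element $a$, either $a\in P$ or $P\subsetneq (a)$; $R$ is locally divided if $R_M$ is divided for every maximal ideal $M$. Finally, $R$ is arithmetical if $(A+B)\cap C=(A\cap C)+(B\cap C)$ for all ideals $A,B,C$ of $R$. Then: (1) If $R$ is strongly $S$-Laskerian, then $\Omega_S(R)\subseteq\mathbb N$. If $R$ is locally divided and $\Omega_S(R)\subseteq\mathbb N$, then $R$ is strongly $S$-Laskerian. (2) If $R$ is arithmetical, then the following are equivalent: (a) $R$ is $S$-Noetherian; (b) $R$ is strongly $S$-Laskerian; (c) $\Omega_S(R)\subseteq\mathbb N$. -/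

import Mathlib

namespace SAbsorbing

variable {R : Type*} [CommRing R]

/-- `I` is disjoint from `S`, and there is one `s ∈ S` such that, whenever `r₁ ⋯ rₙ₊₁ ∈ I`,
the product of `s` with some `n` of the `n + 1` factors lies in `I`. -/
def IsSAbsorbing (S : Subsemigroup R) (n : ℕ) (I : Ideal R) : Prop :=
  Disjoint (I : Set R) (S : Set R) ∧
    ∃ s ∈ S, ∀ r : Fin (n + 1) → R, ∏ i, r i ∈ I →
      ∃ j, s * ∏ i ∈ Finset.univ.erase j, r i ∈ I

/-- The least positive integer `n` such that `I` is `S`-`n`-absorbing, and `⊤` if there is none. -/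
noncomputable def omega (S : Subsemigroup R) (I : Ideal R) : ℕ∞ :=
  sInf {m : ℕ∞ | ∃ n : ℕ, 0 < n ∧ IsSAbsorbing S n I ∧ m = n}

variable (R) in
/-- The set of all values `omega S I`, for `I` an ideal disjoint from `S`. -/
def Omega (S : Subsemigroup R) : Set ℕ∞ :=
  {m | ∃ I : Ideal R, Disjoint (I : Set R) (S : Set R) ∧ m = omega S I}

/-- The set of positive integers, as a set of extended natural numbers. -/
def posNat : Set ℕ∞ := {m | ∃ n : ℕ, 0 < n ∧ m = n}

/-- `S`-primary ideals. -/
def IsSPrimary (S : Subsemigroup R) (I : Ideal R) : Prop :=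
  Disjoint (I : Set R) (S : Set R) ∧
    ∃ s ∈ S, ∀ a b : R, a * b ∈ I → s * a ∈ I ∨ s * b ∈ I.radical

/-- Strongly `S`-primary ideals: `S`-primary ideals `I` with `t (√I)ⁿ ⊆ I` for some `t ∈ S`. -/
def IsStronglySPrimary (S : Subsemigroup R) (I : Ideal R) : Prop :=
  IsSPrimary S I ∧ ∃ n : ℕ, 0 < n ∧ ∃ t ∈ S, Ideal.span {t} * I.radical ^ n ≤ I

variable (R) in
/-- Every ideal disjoint from `S` is the intersection of finitely many strongly `S`-primary
ideals. (An ideal that meets `S` lies in no `S`-primary ideal.) -/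
def IsStronglySLaskerian (S : Subsemigroup R) : Prop :=
  ∀ I : Ideal R, Disjoint (I : Set R) (S : Set R) →
    ∃ F : Finset (Ideal R), (∀ Q ∈ F, IsStronglySPrimary S Q) ∧ I = F.inf id

/-- `I` is `S`-finite: `s I ⊆ J ⊆ I` for some `s ∈ S` and some finitely generated ideal `J`. -/
def IsSFinite (S : Subsemigroup R) (I : Ideal R) : Prop :=
  ∃ s ∈ S, ∃ J : Ideal R, J.FG ∧ Ideal.span {s} * I ≤ J ∧ J ≤ I

variable (R) in
/-- Every ideal is `S`-finite. -/
def IsSNoetherian (S : Subsemigroup R) : Prop :=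
  ∀ I : Ideal R, IsSFinite S I

/-- An ideal `I` is divided if every element outside `I` generates an ideal strictly
containing `I`. -/
def IsDividedIdeal (I : Ideal R) : Prop :=
  ∀ a : R, a ∈ I ∨ I < Ideal.span {a}

variable (R) in
/-- Every prime ideal is divided. -/
def IsDividedRing : Prop :=
  ∀ P : Ideal R, P.IsPrime → IsDividedIdeal P

variable (R) in
/-- The localization at every maximal ideal is a divided ring. -/
def IsLocallyDivided : Prop :=
  ∀ (M : Ideal R) [M.IsMaximal], IsDividedRing (Localization.AtPrime M)

variable (R) in
/-- Arithmetical rings: `(A + B) ∩ C = (A ∩ C) + (B ∩ C)` for all ideals `A`, `B`, `C`. -/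
def IsArithmetical : Prop :=
  ∀ A B C : Ideal R, (A ⊔ B) ⊓ C = (A ⊓ C) ⊔ (B ⊓ C)

end SAbsorbing

namespace SAbsorbing

variable {R : Type*} [CommRing R]

/-! (1) If `Q` is strongly `S`-primary, then (√Q : s) is prime for a suitable `s ∈ S`. Up to an
element of `S`, a product in `Q` needs only its factors in that prime, and only boundedly many of
them (`exists_subset_prod_mem`); over a finite intersection the bounds add up.

Conversely, let `I` be absorbing with `s`. Only finitely many minimal primes of `I` omit `s`
(`finite_minimalPrimes`), and the component of `I` at each of them contains a power of that prime
(`exists_pow_le_component`). In a locally divided ring, let J be the intersection of the components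
at the minimal primes disjoint from `S`. These components are strongly `S`-primary, some `v ∈ S`
satisfies vJ ⊆ I (`exists_components`), and I = J ∩ (I + (v)) (`exists_eq_inf_of_mul_mem`).

(2) If `R` is `S`-Noetherian, a primary decomposition over S⁻¹R is contracted to `R` and corrected
by the same identity. For (c) ⇒ (a), a Cohen-type theorem reduces to primes P disjoint from `S`. An
arithmetical ring is locally a chain ring, hence locally divided; absorption makes P minimal over a
principal ideal, then makes P principal locally at P, and comaximality of minimal primes turns this
into `S`-finiteness. -/

/-- Whenever `r₁ ⋯ rₙ₊₁ ∈ I`, the product of `s` with some `n` of the factors lies in `I`. -/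
def AbsorbsWith (s : R) (n : ℕ) (I : Ideal R) : Prop :=
  ∀ r : Fin (n + 1) → R, ∏ i, r i ∈ I → ∃ j, s * ∏ i ∈ Finset.univ.erase j, r i ∈ I

/-! ### Absorbing ideals, their colons and powers of their radicals -/

theorem prod_erase_zero_cons {n : ℕ} (a : R) (r : Fin n → R) :
    ∏ i ∈ Finset.univ.erase (0 : Fin (n + 1)), (Fin.cons a r : Fin (n + 1) → R) i = ∏ i, r i := by
  rw [show Finset.univ.erase (0 : Fin (n + 1)) = Finset.univ.map (Fin.succEmb n) by
    ext i; refine Fin.cases ?_ (fun i => ?_) i <;> simp]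
  simp

theorem prod_erase_succ_cons {n : ℕ} (a : R) (r : Fin n → R) (j : Fin n) :
    ∏ i ∈ Finset.univ.erase j.succ, (Fin.cons a r : Fin (n + 1) → R) i =
      a * ∏ i ∈ Finset.univ.erase j, r i := by
  classical
  rw [show Finset.univ.erase j.succ =
      insert 0 ((Finset.univ.erase j).map (Fin.succEmb n)) by
    ext i; refine Fin.cases ?_ (fun i => ?_) i <;> simp [eq_comm, Fin.succ_ne_zero]]
  rw [Finset.prod_insert (by simp), Finset.prod_map]
  simp

theorem AbsorbsWith.of_pow_mul_mem {s : R} {n : ℕ} {I : Ideal R} (h : AbsorbsWith s (n + 1) I)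
    {c r : R} (hr : c ^ (n + 1) * r ∈ I) :
    s * c ^ (n + 1) ∈ I ∨ s * (c ^ n * r) ∈ I := by
  obtain ⟨j, hj⟩ := h (Fin.cons r fun _ => c) (by simpa [Fin.prod_univ_succ, mul_comm] using hr)
  revert hj
  refine Fin.cases ?_ (fun j => ?_) j
  · rw [prod_erase_zero_cons]
    intro hj
    left
    simpa using hj
  · rw [prod_erase_succ_cons]
    intro hj
    right
    simpa [mul_comm] using hj

theorem AbsorbsWith.colon {s : R} {n : ℕ} {I : Ideal R} (h : AbsorbsWith s n I) (p : R) :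
    AbsorbsWith s n (I.colon {p}) := by
  intro r hr
  rw [← Fin.cons_self_tail r] at hr ⊢
  generalize r 0 = a, Fin.tail r = y at hr ⊢
  simp only [Submodule.mem_colon_singleton, smul_eq_mul] at hr ⊢
  obtain ⟨j, hj⟩ := h (Fin.cons (p * a) y) (by
    simp only [Fin.prod_univ_succ, Fin.cons_zero, Fin.cons_succ] at hr ⊢
    convert hr using 1; ring)
  refine ⟨j, ?_⟩
  revert hj
  refine Fin.cases ?_ (fun j => ?_) j
  · simp only [prod_erase_zero_cons]
    exact fun hj => I.mul_mem_right _ hj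
  · simp only [prod_erase_succ_cons]
    intro hj
    convert hj using 1; ring

/-- The drop from `n + 1` to `n` drives the induction in `exists_radical_pow_le`. -/
theorem AbsorbsWith.colon_of_sq_mem {n : ℕ} {I : Ideal R} (h : AbsorbsWith 1 (n + 1) I) {z : R}
    (hz : z * z ∈ I) : AbsorbsWith 1 n (I.colon {z}) := by
  intro y hy
  rw [← Fin.cons_self_tail y] at hy ⊢
  generalize y 0 = a, Fin.tail y = y at hy ⊢
  simp only [Submodule.mem_colon_singleton, smul_eq_mul, one_mul] at hy ⊢
  simp only [Fin.prod_univ_succ, Fin.cons_zero, Fin.cons_succ] at hy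
  have key := h (Fin.cons z (Fin.cons a y)) (by
    simp only [Fin.prod_univ_succ, Fin.cons_zero, Fin.cons_succ]
    convert hy using 1; ring)
  obtain ⟨j, hj⟩ := key
  revert hj
  refine Fin.cases ?_ (fun j => ?_) j
  swap
  · simp only [prod_erase_succ_cons, one_mul]
    exact fun hj => ⟨j, by rwa [mul_comm]⟩
  simp only [prod_erase_zero_cons, one_mul, Fin.prod_univ_succ, Fin.cons_zero, Fin.cons_succ]
  intro hay
  -- Only `z` could be discarded so far. As `z * z ∈ I`, replacing `a` by `a + z` keeps the product
  -- in `I`, and subtraction then removes the extra term.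
  obtain ⟨j, hj⟩ := h (Fin.cons z (Fin.cons (a + z) y)) (by
    simp only [Fin.prod_univ_succ, Fin.cons_zero, Fin.cons_succ]
    convert I.add_mem hy (I.mul_mem_right (∏ i, y i) hz) using 1; ring)
  revert hj
  refine Fin.cases ?_ (fun j => ?_) j
  · simp only [prod_erase_zero_cons, one_mul, Fin.prod_univ_succ, Fin.cons_zero, Fin.cons_succ]
    intro hj
    refine ⟨0, ?_⟩
    rw [prod_erase_zero_cons]
    convert I.sub_mem hj hay using 1; ring
  refine Fin.cases ?_ (fun j => ?_) j
  · simp only [prod_erase_succ_cons, prod_erase_zero_cons, one_mul]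
    intro hj
    refine ⟨0, ?_⟩
    rw [prod_erase_zero_cons]
    rwa [mul_comm]
  · simp only [prod_erase_succ_cons, one_mul]
    intro hj
    refine ⟨j.succ, ?_⟩
    rw [prod_erase_succ_cons]
    convert I.sub_mem hj (I.mul_mem_right (∏ i ∈ Finset.univ.erase j, y i) hz) using 1; ring

theorem AbsorbsWith.eq_top_of_zero {I : Ideal R} (h : AbsorbsWith 1 0 I) : I = ⊤ := by
  obtain ⟨j, hj⟩ := h (fun _ => 0) (by simp)
  rw [Ideal.eq_top_iff_one]
  fin_cases j
  simpa using hj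

theorem AbsorbsWith.pow_mem {n : ℕ} {I : Ideal R} (h : AbsorbsWith 1 n I) {x : R}
    (hx : x ∈ I.radical) : x ^ n ∈ I := by
  obtain _ | n := n
  · simp [h.eq_top_of_zero]
  obtain ⟨m, hm⟩ := hx
  induction m with
  | zero => simpa using I.mul_mem_left (x ^ (n + 1)) hm
  | succ m ih =>
    by_cases hmn : m + 1 ≤ n + 1
    · exact I.pow_mem_of_pow_mem hm hmn
    obtain ⟨k, rfl⟩ := Nat.exists_eq_add_of_le (show n + 1 ≤ m by omega)
    rcases h.of_pow_mul_mem (c := x) (r := x ^ (k + 1)) (by convert hm using 1; ring) with h1 | h1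
    · simpa using h1
    · refine ih ?_
      convert h1 using 1; ring

/-- Induction on the exponent. If `x ^ (k + 2) ∈ I`, then `x ^ (k + 1)` squares into `I`, so its
colon is `n`-absorbing and contains `P ^ N`. Hence for `p ∈ P ^ N` the colon of `p` contains all `x
^ (k + 1)`, an exponent one lower. -/
theorem AbsorbsWith.exists_pow_le_of_pow_mem {n N : ℕ}
    (hN : ∀ I : Ideal R, AbsorbsWith 1 n I → I.radical ^ N ≤ I) (k : ℕ) :
    ∃ K : ℕ, ∀ I : Ideal R, AbsorbsWith 1 (n + 1) I → ∀ P : Ideal R, P ≤ I.radical →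
      (∀ x ∈ P, x ^ (k + 1) ∈ I) → P ^ K ≤ I := by
  induction k with
  | zero => exact ⟨1, fun I _ P _ hx => by simpa using! hx⟩
  | succ k ih =>
    obtain ⟨K, hK⟩ := ih
    refine ⟨K + N, fun I hI P hP hx => ?_⟩
    rw [pow_add, Ideal.mul_le]
    intro r hr p hp
    have h1 : P ^ K ≤ I.colon {p} := by
      refine hK _ (hI.colon p) P (hP.trans (Ideal.radical_mono Ideal.le_colon)) fun x hxP => ?_
      have h2 : P ^ N ≤ I.colon {x ^ (k + 1)} :=
        (Ideal.pow_right_mono (hP.trans (Ideal.radical_mono Ideal.le_colon)) N).trans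
          (hN _ (hI.colon_of_sq_mem (by
            rw [← pow_add]; exact I.pow_mem_of_pow_mem (hx x hxP) (by omega))))
      have := h2 hp
      rw [Submodule.mem_colon_singleton, smul_eq_mul] at this ⊢
      rwa [mul_comm]
    simpa using Submodule.mem_colon_singleton.1 (h1 hr)

variable (R) in
/-- The exponent `N` depends on `n` only. -/
theorem AbsorbsWith.exists_radical_pow_le (n : ℕ) :
    ∃ N : ℕ, ∀ I : Ideal R, AbsorbsWith 1 n I → I.radical ^ N ≤ I := by
  induction n with
  | zero => exact ⟨0, fun I hI => by simp [hI.eq_top_of_zero]⟩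
  | succ n ih =>
    obtain ⟨N, hN⟩ := ih
    obtain ⟨K, hK⟩ := AbsorbsWith.exists_pow_le_of_pow_mem hN n
    exact ⟨K, fun I hI => hK I hI _ le_rfl fun x hx => hI.pow_mem hx⟩

/-! ### Minimal primes and components -/

/-- The kernel of `R → (R ⧸ I)_P`. -/
def component (I P : Ideal R) [P.IsPrime] : Ideal R where
  carrier := {x | ∃ c ∉ P, c * x ∈ I}
  zero_mem' := ⟨1, P.ne_top_iff_one.1 Ideal.IsPrime.ne_top', by simp⟩
  add_mem' := by
    rintro x y ⟨c, hc, hx⟩ ⟨d, hd, hy⟩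
    refine ⟨c * d, fun h => (Ideal.IsPrime.mem_or_mem ‹_› h).elim hc hd, ?_⟩
    convert I.add_mem (I.mul_mem_left d hx) (I.mul_mem_left c hy) using 1; ring
  smul_mem' := by
    rintro a x ⟨c, hc, hx⟩
    refine ⟨c, hc, ?_⟩
    convert I.mul_mem_left a hx using 1; simp only [smul_eq_mul]; ring

theorem mem_component {I P : Ideal R} [P.IsPrime] {x : R} :
    x ∈ component I P ↔ ∃ c ∉ P, c * x ∈ I := Iff.rfl

theorem le_component (I P : Ideal R) [hP : P.IsPrime] : I ≤ component I P :=
  fun x hx => ⟨1, P.ne_top_iff_one.1 hP.ne_top', by simpa⟩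

theorem component_le {I P : Ideal R} [hP : P.IsPrime] (h : I ≤ P) : component I P ≤ P := by
  rintro x ⟨c, hc, hx⟩
  exact (hP.mem_or_mem (h hx)).resolve_left hc

theorem mem_component_of_mul_mem {I P : Ideal R} [hP : P.IsPrime] {c x : R} (hc : c ∉ P)
    (h : c * x ∈ component I P) : x ∈ component I P := by
  obtain ⟨d, hd, h⟩ := h
  exact ⟨d * c, fun h => (hP.mem_or_mem h).elim hd hc, by rwa [mul_assoc]⟩

theorem exists_prime_le_of_forall_mul_pow_notMem {I M : Ideal R} [hM : M.IsPrime] {w : R}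
    (h : ∀ c ∉ M, ∀ k, c * w ^ k ∉ I) : ∃ P ∈ I.minimalPrimes, P ≤ M ∧ w ∉ P := by
  obtain ⟨Q, hQ, hIQ, hd⟩ := Ideal.exists_le_prime_disjoint I (M.primeCompl ⊔ Submonoid.powers w) (by
    rw [Set.disjoint_right]
    intro x hx hxI
    obtain ⟨c, hc, _, ⟨k, rfl⟩, rfl⟩ := Submonoid.mem_sup.1 hx
    exact h c hc k hxI)
  obtain ⟨P, hP, hPQ⟩ := Ideal.exists_minimalPrimes_le hIQ
  rw [Set.disjoint_left] at hd
  refine ⟨P, hP, fun x hx => ?_, fun hw => ?_⟩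
  · by_contra hxM
    exact hd (hPQ hx) (Submonoid.mem_sup_left hxM)
  · exact hd (hPQ hw) (Submonoid.mem_sup_right (Submonoid.mem_powers w))

theorem exists_mul_pow_mem_of_mem_minimalPrimes {I P : Ideal R} (hP : P ∈ I.minimalPrimes) {x : R}
    (hx : x ∈ P) : ∃ c ∉ P, ∃ k, c * x ^ k ∈ I := by
  have := hP.1.1
  by_contra! h
  obtain ⟨Q, hQ, hQP, hxQ⟩ := exists_prime_le_of_forall_mul_pow_notMem h
  exact hxQ (hP.2 hQ.1 hQP hx)

theorem radical_component {I P : Ideal R} [P.IsPrime] (hP : P ∈ I.minimalPrimes) :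
    (component I P).radical = P := by
  apply le_antisymm
  · exact (Ideal.radical_mono (component_le hP.1.2)).trans (Ideal.IsPrime.radical ‹_›).le
  · intro x hx
    obtain ⟨c, hc, k, hk⟩ := exists_mul_pow_mem_of_mem_minimalPrimes hP hx
    exact ⟨k, c, hc, hk⟩

theorem AbsorbsWith.component {s : R} {n : ℕ} {I P : Ideal R} [hP : P.IsPrime]
    (h : AbsorbsWith s n I) (hs : s ∉ P) : AbsorbsWith 1 n (component I P) := by
  rintro r ⟨c, hc, hr⟩
  obtain ⟨j, hj⟩ := h.colon c r (by simpa [mul_comm] using hr)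
  refine ⟨j, c * s, fun h => (hP.mem_or_mem h).elim hc hs, ?_⟩
  rw [Submodule.mem_colon_singleton, smul_eq_mul] at hj
  convert hj using 1; ring

theorem AbsorbsWith.exists_pow_le_component {s : R} {n : ℕ} {I P : Ideal R} [P.IsPrime]
    (h : AbsorbsWith s n I) (hs : s ∉ P) (hP : P ∈ I.minimalPrimes) :
    ∃ N : ℕ, P ^ N ≤ SAbsorbing.component I P := by
  obtain ⟨N, hN⟩ := AbsorbsWith.exists_radical_pow_le R n
  refine ⟨N, ?_⟩
  have := hN _ (h.component hs)
  rwa [radical_component hP] at this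

/-- There are at most `n` such primes: given `n + 1`, a product of `n + 1` factors in `I` is built
such that, for every `j`, only the `j`-th factor lies in `f j`. Discarding any factor then
contradicts primality. -/
theorem AbsorbsWith.finite_minimalPrimes {s : R} {n : ℕ} {I : Ideal R} (h : AbsorbsWith s n I) :
    {P ∈ I.minimalPrimes | s ∉ P}.Finite := by
  classical
  by_contra hinf
  obtain ⟨f, hf⟩ : ∃ f : Fin (n + 1) → Ideal R, Function.Injective f ∧
      ∀ i, f i ∈ I.minimalPrimes ∧ s ∉ f i :=
    ⟨fun i => Set.Infinite.natEmbedding _ hinf i,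
      fun i j hij => Fin.ext ((Set.Infinite.natEmbedding _ hinf).injective (Subtype.ext hij)),
      fun i => (Set.Infinite.natEmbedding _ hinf i).2⟩
  obtain ⟨hinj, hf⟩ := hf
  have hprime : ∀ i, (f i).IsPrime := fun i => (hf i).1.1.1
  have avoid : ∀ (J : Ideal R) (T : Finset (Fin (n + 1))), (∀ i ∈ T, ¬ J ≤ f i) →
      ∃ e ∈ J, ∀ i ∈ T, e ∉ f i := by
    intro J T hT
    by_contra! hcon
    obtain ⟨i, hi, hle⟩ := (Ideal.subset_union_prime (s := T) (f := f) 0 0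
      fun i _ _ _ => hprime i).1 (show (J : Set R) ⊆ _ from fun e he => by
        obtain ⟨i, hi, h⟩ := hcon e he
        exact Set.mem_biUnion (Finset.mem_coe.2 hi) h)
    exact hT i hi hle
  have h1 : ∀ i, ∃ e ∈ f i, ∀ j, j ≠ i → e ∉ f j := by
    intro i
    obtain ⟨e, he, h⟩ := avoid (f i) (Finset.univ.erase i) fun j hj hle =>
      (Finset.mem_erase.1 hj).1 (hinj (le_antisymm ((hf j).1.2 ⟨hprime i, (hf i).1.1.2⟩ hle) hle))
    exact ⟨e, he, fun j hj => h j (by simp [hj])⟩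
  choose e he he' using h1
  have hprod : ∀ j, ∏ i, e i ∈ f j := fun j =>
    Ideal.mem_of_dvd _ (Finset.dvd_prod_of_mem e (Finset.mem_univ j)) (he j)
  have h2 : ∀ j, ∃ k, ∃ c ∉ f j, c * (∏ i, e i) ^ k ∈ I := fun j => by
    obtain ⟨c, hc, k, hk⟩ := exists_mul_pow_mem_of_mem_minimalPrimes (hf j).1 (hprod j)
    exact ⟨k, c, hc, hk⟩
  choose k c hc hck using h2
  set K := (Finset.univ.sup k) + 1 with hK
  -- The exponent `K` serves all the primes at once, so prime avoidance merges the multipliers `c j`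
  -- into a single `d` outside every `f j`.
  obtain ⟨d, hd, hd'⟩ := avoid (I.colon {(∏ i, e i) ^ K}) Finset.univ fun j _ hle => by
    refine hc j (hle ?_)
    rw [Submodule.mem_colon_singleton, smul_eq_mul]
    have : k j ≤ K := (Finset.le_sup (Finset.mem_univ j)).trans (Nat.le_succ _)
    obtain ⟨l, hl⟩ := Nat.exists_eq_add_of_le this
    rw [hl, pow_add, ← mul_assoc]
    exact I.mul_mem_right _ (hck j)
  rw [Submodule.mem_colon_singleton, smul_eq_mul] at hd
  have hK0 : K ≠ 0 := by omega
  obtain ⟨j, hj⟩ := h (fun i => if i = 0 then d * e i ^ K else e i ^ K) (by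
    convert hd using 1
    simp [Fin.prod_univ_succ, mul_pow, Finset.prod_pow, mul_assoc, Fin.succ_ne_zero])
  have hj' := (hf j).1.1.2 hj
  rcases (hprime j).mem_or_mem hj' with h3 | h3
  · exact (hf j).2 h3
  · obtain ⟨i, hi, h4⟩ := (Ideal.IsPrime.prod_mem_iff (hp := hprime j)).1 h3
    have hij : e i ∉ f j := he' i j (Finset.ne_of_mem_erase hi).symm
    have h5 : e i ^ K ∉ f j := fun h => hij ((hprime j).mem_of_pow_mem _ h)
    split_ifs at h4
    · exact ((hprime j).mem_or_mem h4).elim (hd' j (Finset.mem_univ j)) h5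
    · exact h5 h4

/-! ### Components in locally divided rings -/

variable (R) in
/-- Locally divided rings, in terms of elements. -/
def IsElementwiseLocallyDivided : Prop :=
  ∀ M : Ideal R, M.IsMaximal → ∀ P : Ideal R, P.IsPrime → P ≤ M →
    ∀ a ∉ P, ∀ p ∈ P, ∃ c ∉ M, ∃ r, c * p = a * r

theorem IsLocallyDivided.elementwise (h : IsLocallyDivided R) :
    IsElementwiseLocallyDivided R := by
  intro M hM P hP hPM a ha p hp
  have hdisj : Disjoint (M.primeCompl : Set R) (P : Set R) :=
    Set.disjoint_left.2 fun x hx hxP => hx (hPM hxP)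
  have hprime : (P.map (algebraMap R (Localization.AtPrime M))).IsPrime :=
    IsLocalization.isPrime_of_isPrime_disjoint M.primeCompl _ P hP hdisj
  have hcomap := IsLocalization.under_map_of_isPrime_disjoint M.primeCompl
    (Localization.AtPrime M) hP hdisj
  rcases h M _ hprime (algebraMap R _ a) with h1 | h1
  · exact absurd (hcomap.le (Ideal.mem_comap.2 h1)) ha
  · have h2 := h1.le (Ideal.mem_map_of_mem _ hp)
    rw [Ideal.mem_span_singleton] at h2
    obtain ⟨z, hz⟩ := h2
    obtain ⟨r, t, rfl⟩ := IsLocalization.exists_mk'_eq M.primeCompl z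
    rw [IsLocalization.mul_mk'_eq_mk'_of_mul, IsLocalization.eq_mk'_iff_mul_eq, ← map_mul] at hz
    obtain ⟨c, hc⟩ := (IsLocalization.eq_iff_exists M.primeCompl _).1 hz
    refine ⟨c * t, M.primeCompl.mul_mem c.2 t.2, c * r, ?_⟩
    linear_combination hc

theorem IsElementwiseLocallyDivided.exists_mul_mem (hR : IsElementwiseLocallyDivided R) {s : R}
    {n : ℕ} {I : Ideal R} (h : AbsorbsWith s (n + 1) I) {P M : Ideal R} (hP : P.IsPrime)
    (hIP : I ≤ P) (hs : s ∉ P) (hM : M.IsMaximal) (hPM : P ≤ M) {c x : R} (hc : c ∉ P)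
    (hcx : c * x ∈ I) : ∃ d ∉ M, s * (d * x) ∈ I := by
  have hx : x ∈ P := (hP.mem_or_mem (hIP hcx)).resolve_left hc
  have hcn : ∀ k, c ^ k ∉ P := fun k h => hc (hP.mem_of_pow_mem _ h)
  -- Dividing by `c ^ n` rather than by `c` gives `c ^ (n + 1) * r = d * (c * x)`, a product in `I`
  -- with enough equal factors for absorption.
  obtain ⟨d, hd, r, hdr⟩ := hR M hM P hP hPM (c ^ n) (hcn n) x hx
  refine ⟨d, hd, ?_⟩
  rcases h.of_pow_mul_mem (c := c) (r := r) (by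
    convert I.mul_mem_left d hcx using 1
    rw [pow_succ]; linear_combination -c * hdr) with h1 | h1
  · exact absurd (hIP h1) fun h2 => (hP.mem_or_mem h2).elim hs (hcn _)
  · rwa [hdr]

/-- The ascending chain of colons by powers of `s * t` stabilizes. Absorption is applied to squares:
losing one square costs two factors `s * t`, and the gained `s` together with an extra `t` restores
one, a net drop of one. -/
theorem AbsorbsWith.mul_pow_mem {S : Subsemigroup R} {s t : R} {n : ℕ} {I : Ideal R}
    (h : AbsorbsWith s (n + 1) I) (hI : Disjoint (I : Set R) (S : Set R)) (hs : s ∈ S)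
    (hst : s * t ∈ S) {d : R} {m : ℕ} (hd : d * (s * t) ^ m ∈ I) :
    d * (s * t) ^ (2 * n + 2) ∈ I := by
  rw [Set.disjoint_left] at hI
  have hpow : ∀ (x : R), x ∈ S → ∀ k : ℕ, x ^ (k + 1) ∈ S := fun x hx k => by
    induction k with
    | zero => simpa
    | succ k ih => rw [pow_succ]; exact mul_mem ih hx
  induction m with
  | zero => exact I.mul_mem_right _ (by simpa using hd)
  | succ m ih =>
    by_cases hm : m + 1 ≤ 2 * n + 2
    · obtain ⟨k, hk⟩ := Nat.exists_eq_add_of_le hm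
      rw [hk, pow_add, ← mul_assoc]
      exact I.mul_mem_right _ hd
    obtain ⟨k, rfl⟩ := Nat.exists_eq_add_of_le (show 2 * n + 2 ≤ m by omega)
    rcases h.of_pow_mul_mem (c := (s * t) ^ 2) (r := d * (s * t) ^ (k + 1)) (by
      convert hd using 1; ring) with h1 | h1
    · exact absurd (mul_mem hs (hpow _ (hpow _ hst 1) n)) (hI h1)
    · refine ih ?_
      convert I.mul_mem_left t h1 using 1; ring

/-- `S` need not contain 1; the leading factor covers an empty product. -/
theorem mul_prod_mem {S : Subsemigroup R} {ι : Type*} {s : R} (hs : s ∈ S) (T : Finset ι)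
    {u : ι → R} (hu : ∀ i ∈ T, u i ∈ S) : s * ∏ i ∈ T, u i ∈ S := by
  classical
  induction T using Finset.induction_on with
  | empty => simpa
  | insert i T hi ih =>
    rw [Finset.prod_insert hi, mul_left_comm]
    exact mul_mem (hu i (by simp)) (ih fun j hj => hu j (by simp [hj]))

/-- Up to an element of `S`, an `S`-absorbing ideal of a locally divided ring is the intersection
of its components at finitely many minimal primes. -/
theorem IsElementwiseLocallyDivided.exists_components (hR : IsElementwiseLocallyDivided R)
    {S : Subsemigroup R} {s : R} {n : ℕ} {I : Ideal R} (hs : s ∈ S)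
    (h : AbsorbsWith s (n + 1) I) (hI : Disjoint (I : Set R) (S : Set R)) :
    ∃ v ∈ S, ∃ T : Finset (Ideal R),
      (∀ P ∈ T, P ∈ I.minimalPrimes ∧ Disjoint (P : Set R) (S : Set R)) ∧
      ∀ x, (∀ P ∈ T, ∀ _ : P.IsPrime, x ∈ component I P) → v * x ∈ I := by
  classical
  set T₀ := h.finite_minimalPrimes.toFinset with hT₀
  have hT₀' : ∀ P, P ∈ T₀ ↔ P ∈ I.minimalPrimes ∧ s ∉ P := fun P => by simp [hT₀]
  have hu : ∀ P : Ideal R, ∃ u ∈ S, ¬ Disjoint (P : Set R) (S : Set R) → u ∈ P := by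
    intro P
    by_cases hP : Disjoint (P : Set R) (S : Set R)
    · exact ⟨s, hs, fun h => absurd hP h⟩
    · obtain ⟨u, h1, h2⟩ := Set.not_disjoint_iff.1 hP
      exact ⟨u, h2, fun _ => h1⟩
  choose u huS huP using hu
  set t := ∏ P ∈ T₀, u P with ht
  have hstS : s * t ∈ S := mul_prod_mem hs T₀ fun P _ => huS P
  have hw : ∀ P ∈ I.minimalPrimes, ¬ Disjoint (P : Set R) (S : Set R) → s * t ∈ P := by
    intro P hP hPS
    by_cases hsP : s ∈ P
    · exact P.mul_mem_right _ hsP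
    · exact P.mul_mem_left _ (Ideal.mem_of_dvd _
        (Finset.dvd_prod_of_mem u ((hT₀' P).2 ⟨hP, hsP⟩)) (huP P hPS))
  have hpow : ∀ k : ℕ, s * (s * t) ^ k ∈ S := fun k => by
    induction k with
    | zero => simpa
    | succ k ih => rw [pow_succ, ← mul_assoc]; exact mul_mem ih hstS
  refine ⟨s * (s * t) ^ (2 * n + 2), hpow _,
    T₀.filter fun P => Disjoint (P : Set R) (S : Set R), ?_, ?_⟩
  · intro P hP
    rw [Finset.mem_filter, hT₀'] at hP
    exact ⟨hP.1.1, hP.2⟩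
  · intro x hx
    by_contra hcon
    have hne : I.colon {s * (s * t) ^ (2 * n + 2) * x} ≠ ⊤ := by
      rw [Ne, Ideal.eq_top_iff_one, Submodule.mem_colon_singleton, one_smul]
      exact hcon
    obtain ⟨M, hM, hle⟩ := Ideal.exists_le_maximal _ hne
    have hnot : ∀ d ∉ M, d * (s * (s * t) ^ (2 * n + 2) * x) ∉ I := fun d hd hdI =>
      hd (hle (Submodule.mem_colon_singleton.2 hdI))
    -- If every minimal prime inside `M` contained `s * t`, then `s * t` would be nilpotent modulo
    -- `I` locally at `M`, and `mul_pow_mem` would bound the exponent by `2 * n + 2`.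
    obtain ⟨P, hP, hPM, hwP⟩ : ∃ P ∈ I.minimalPrimes, P ≤ M ∧ s * t ∉ P := by
      have := hM.isPrime
      refine exists_prime_le_of_forall_mul_pow_notMem fun d hd m hdm => hnot d hd ?_
      have := I.mul_mem_right (s * x) (h.mul_pow_mem hI hs hstS hdm)
      convert this using 1; ring
    have hPS : Disjoint (P : Set R) (S : Set R) := by
      by_contra hPS
      exact hwP (hw P hP hPS)
    have hsP : s ∉ P := fun hsP => Set.disjoint_left.1 hPS hsP hs
    have hPp : P.IsPrime := hP.1.1
    obtain ⟨c, hc, hcx⟩ := hx P (by simp [hT₀', hP, hsP, hPS]) hPp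
    obtain ⟨d, hd, hdx⟩ := hR.exists_mul_mem h hPp hP.1.2 hsP hM hPM hc hcx
    refine hnot d hd ?_
    convert I.mul_mem_left ((s * t) ^ (2 * n + 2)) hdx using 1; ring

/-! ### From strongly `S`-Laskerian to absorbing -/

theorem Omega_subset_posNat_iff {S : Subsemigroup R} :
    Omega R S ⊆ posNat ↔
      ∀ I : Ideal R, Disjoint (I : Set R) (S : Set R) → ∃ n, IsSAbsorbing S (n + 1) I := by
  constructor
  · intro h I hI
    obtain ⟨m, -, hm⟩ := h ⟨I, hI, rfl⟩
    have hne : {m : ℕ∞ | ∃ n : ℕ, 0 < n ∧ IsSAbsorbing S n I ∧ m = n}.Nonempty := by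
      by_contra hne
      rw [Set.not_nonempty_iff_eq_empty] at hne
      rw [omega, hne, sInf_empty] at hm
      exact ENat.top_ne_natCast m hm
    obtain ⟨_, n, hn, hI, -⟩ := hne
    obtain ⟨n, rfl⟩ := Nat.exists_eq_succ_of_ne_zero hn.ne'
    exact ⟨n, hI⟩
  · rintro h _ ⟨I, hI, rfl⟩
    obtain ⟨n, hn⟩ := h I hI
    obtain ⟨m, hm, -, h⟩ := csInf_mem (s := {m : ℕ∞ | ∃ n : ℕ, 0 < n ∧ IsSAbsorbing S n I ∧ m = n})
      ⟨_, n + 1, n.succ_pos, hn, rfl⟩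
    exact ⟨m, hm, h⟩

theorem mul_pow_mem_subsemigroup {S : Subsemigroup R} {s t : R} (ht : t ∈ S) (hs : s ∈ S) (n : ℕ) :
    t * s ^ n ∈ S := by
  simpa using mul_prod_mem ht (Finset.range n) (u := fun _ => s) fun _ _ => hs

theorem IsSPrimary.isPrime_radical_colon {S : Subsemigroup R} {Q : Ideal R} {s : R}
    (hQ : Disjoint (Q : Set R) (S : Set R)) (hs : s ∈ S)
    (h : ∀ a b : R, a * b ∈ Q → s * a ∈ Q ∨ s * b ∈ Q.radical) :
    (Q.radical.colon {s}).IsPrime := by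
  constructor
  · rw [Ne, Ideal.eq_top_iff_one, Submodule.mem_colon_singleton, one_smul]
    rintro ⟨k, hk⟩
    refine Set.disjoint_left.1 hQ ?_ (mul_pow_mem_subsemigroup hs hs k)
    exact Q.mul_mem_left _ hk
  · intro a b hab
    simp only [Submodule.mem_colon_singleton, smul_eq_mul] at hab ⊢
    have hsq : ∀ x, s * (s * x) ∈ Q.radical → x * s ∈ Q.radical := fun x hx => by
      rw [Ideal.mem_radical_iff] at hx ⊢
      obtain ⟨k, hk⟩ := hx
      refine ⟨2 * k, ?_⟩
      convert Q.mul_mem_left (x ^ k) hk using 1; ring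
    obtain ⟨k, hk⟩ := hab
    rcases h ((s * a) ^ k) (b ^ k) (by convert hk using 1; ring) with h1 | h1
    · refine Or.inl (hsq a ⟨k + 1, ?_⟩)
      convert Q.mul_mem_left (s ^ k * (s * a)) h1 using 1; ring
    · right
      rw [Ideal.mem_radical_iff] at h1 ⊢
      obtain ⟨l, hl⟩ := h1
      refine ⟨k * l + l, ?_⟩
      convert Q.mul_mem_left (s ^ (k * l) * b ^ l) hl using 1; ring

theorem IsStronglySPrimary.exists_subset_prod_mem {S : Subsemigroup R} {Q : Ideal R}
    (hQ : IsStronglySPrimary S Q) : ∃ u ∈ S, ∃ n : ℕ, ∀ (ι : Type) (T : Finset ι) (r : ι → R),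
      ∏ i ∈ T, r i ∈ Q → ∃ A ⊆ T, A.card ≤ n ∧ u * ∏ i ∈ A, r i ∈ Q := by
  classical
  obtain ⟨⟨hd, s, hs, hQ⟩, n, -, t, ht, hn⟩ := hQ
  have hP := IsSPrimary.isPrime_radical_colon hd hs hQ
  have hmem : ∀ x, x ∈ Q.radical.colon {s} ↔ s * x ∈ Q.radical := fun x => by
    rw [Submodule.mem_colon_singleton, smul_eq_mul, mul_comm]
  -- With at most `n` factors in the prime, `s` suffices; otherwise any `n` of them, each multiplied
  -- by `s`, need `t * s ^ n`. The chosen element is a multiple of both.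
  refine ⟨t * s ^ (n + 1), mul_pow_mem_subsemigroup ht hs _, n, fun ι T r hr => ?_⟩
  set A := T.filter fun i => r i ∈ Q.radical.colon {s} with hA
  have hsA : s * ∏ i ∈ A, r i ∈ Q := by
    rw [← Finset.prod_filter_mul_prod_filter_not T (fun i => r i ∈ Q.radical.colon {s})] at hr
    refine (hQ _ _ hr).resolve_right ?_
    rw [← hmem, hP.prod_mem_iff]
    rintro ⟨i, hi, h⟩
    exact (Finset.mem_filter.1 hi).2 h
  by_cases hcard : A.card ≤ n
  · refine ⟨A, Finset.filter_subset _ _, hcard, ?_⟩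
    convert Q.mul_mem_left (t * s ^ n) hsA using 1; ring
  · obtain ⟨B, hBA, hB⟩ := Finset.exists_subset_card_eq (not_le.1 hcard).le
    refine ⟨B, hBA.trans (Finset.filter_subset _ _), hB.le, ?_⟩
    have h1 : ∏ i ∈ B, s * r i ∈ Q.radical ^ n := by
      rw [← hB, ← Finset.prod_const]
      refine Ideal.prod_mem_prod fun i hi => ?_
      exact (hmem _).1 (Finset.mem_filter.1 (hBA hi)).2
    have h2 := hn (Ideal.mul_mem_mul (Ideal.mem_span_singleton_self t) h1)
    rw [Finset.prod_mul_distrib, Finset.prod_const, hB] at h2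
    convert Q.mul_mem_left s h2 using 1; ring

theorem IsStronglySLaskerian.exists_isSAbsorbing {S : Subsemigroup R} (hS : (S : Set R).Nonempty)
    (h : IsStronglySLaskerian R S) {I : Ideal R} (hI : Disjoint (I : Set R) (S : Set R)) :
    ∃ n, IsSAbsorbing S (n + 1) I := by
  classical
  obtain ⟨F, hF, hIF⟩ := h I hI
  obtain ⟨s, hs⟩ := hS
  have key : ∀ Q : Ideal R, ∃ u ∈ S, ∃ n : ℕ, Q ∈ F → ∀ (ι : Type) (T : Finset ι) (r : ι → R),
      ∏ i ∈ T, r i ∈ Q → ∃ A ⊆ T, A.card ≤ n ∧ u * ∏ i ∈ A, r i ∈ Q := by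
    intro Q
    by_cases hQ : Q ∈ F
    · obtain ⟨u, hu, n, h⟩ := (hF Q hQ).exists_subset_prod_mem
      exact ⟨u, hu, n, fun _ => h⟩
    · exact ⟨s, hs, 0, fun h => absurd h hQ⟩
  choose u hu n hn using key
  refine ⟨∑ Q ∈ F, n Q, hI, s * ∏ Q ∈ F, u Q, mul_prod_mem hs F fun Q _ => hu Q, fun r hr => ?_⟩
  have hA : ∀ Q, ∃ A : Finset (Fin (∑ Q ∈ F, n Q + 1 + 1)), Q ∈ F →
      A.card ≤ n Q ∧ u Q * ∏ i ∈ A, r i ∈ Q := by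
    intro Q
    by_cases hQ : Q ∈ F
    · rw [hIF, Submodule.mem_finsetInf] at hr
      obtain ⟨A, -, hA⟩ := hn Q hQ _ Finset.univ r (hr Q hQ)
      exact ⟨A, fun _ => hA⟩
    · exact ⟨∅, fun h => absurd h hQ⟩
  choose A hA using hA
  -- The sets `A Q` have at most `∑ Q ∈ F, n Q` indices in total, so some index is needed by no `Q`.
  obtain ⟨j, hj⟩ : ∃ j, j ∉ F.biUnion A := by
    by_contra! hall
    have h1 : (F.biUnion A).card ≤ ∑ Q ∈ F, n Q :=
      Finset.card_biUnion_le.trans (Finset.sum_le_sum fun Q hQ => (hA Q hQ).1)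
    rw [Finset.eq_univ_iff_forall.2 hall, Finset.card_univ, Fintype.card_fin] at h1
    omega
  refine ⟨j, ?_⟩
  rw [hIF, Submodule.mem_finsetInf]
  intro Q hQ
  refine Ideal.mem_of_dvd _ (mul_dvd_mul ((Finset.dvd_prod_of_mem u hQ).mul_left s)
    (Finset.prod_dvd_prod_of_subset _ _ r fun i hi => ?_)) (hA Q hQ).2
  refine Finset.mem_erase.2 ⟨?_, Finset.mem_univ _⟩
  rintro rfl
  exact hj (Finset.mem_biUnion.2 ⟨Q, hQ, hi⟩)

/-! ### From absorbing to strongly `S`-Laskerian -/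

theorem IsStronglySPrimary.inf {S : Subsemigroup R} {Q L : Ideal R} (hQ : IsStronglySPrimary S Q)
    {v : R} (hv : v ∈ S) (hvL : v ∈ L) : IsStronglySPrimary S (Q ⊓ L) := by
  obtain ⟨⟨hd, s, hs, hQ⟩, n, hn0, t, ht, hn⟩ := hQ
  refine ⟨⟨hd.mono_left fun x hx => hx.1, v * s, mul_mem hv hs, fun a b hab => ?_⟩, n, hn0,
    v * t, mul_mem hv ht, ?_⟩
  · rcases hQ a b hab.1 with h | h
    · left
      rw [mul_assoc]
      exact ⟨Q.mul_mem_left _ h, L.mul_mem_right _ hvL⟩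
    · right
      rw [mul_assoc, Ideal.radical_inf]
      exact ⟨Ideal.mul_mem_left _ _ h, Ideal.mul_mem_right _ _ (Ideal.le_radical hvL)⟩
  · rw [Ideal.span_singleton_mul_le_iff]
    intro z hz
    have hz' := hn (Ideal.mul_mem_mul (Ideal.mem_span_singleton_self t)
      (Ideal.pow_right_mono (Ideal.radical_mono inf_le_left) n hz))
    rw [mul_assoc]
    exact ⟨Q.mul_mem_left _ hz', L.mul_mem_right _ hvL⟩

/-- With J the infimum of `F`, the identity is I = J ∩ (I + (v)): if i + vy ∈ J, then vy ∈ J, so y ∈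
J by saturation and vy ∈ I. Since `v` lies in I + (v), intersecting each member with that ideal
preserves strong `S`-primarity. -/
theorem exists_eq_inf_of_mul_mem {S : Subsemigroup R} {I : Ideal R}
    (hI : Disjoint (I : Set R) (S : Set R)) {v : R} (hv : v ∈ S) {F : Finset (Ideal R)}
    (hF : ∀ Q ∈ F, IsStronglySPrimary S Q) (hIF : I ≤ F.inf id)
    (hvF : ∀ x ∈ F.inf id, v * x ∈ I) (hsat : ∀ x, v * x ∈ F.inf id → x ∈ F.inf id) :
    ∃ F' : Finset (Ideal R), (∀ Q ∈ F', IsStronglySPrimary S Q) ∧ I = F'.inf id := by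
  classical
  have hvL : v ∈ I ⊔ Ideal.span {v} :=
    Ideal.mem_sup_right (Ideal.mem_span_singleton_self v)
  refine ⟨F.image (· ⊓ (I ⊔ Ideal.span {v})), ?_, le_antisymm ?_ fun x hx => ?_⟩
  · intro Q hQ
    obtain ⟨Q, hQF, rfl⟩ := Finset.mem_image.1 hQ
    exact (hF Q hQF).inf hv hvL
  · refine Finset.le_inf fun Q hQ => ?_
    obtain ⟨Q, hQF, rfl⟩ := Finset.mem_image.1 hQ
    exact le_inf (hIF.trans (Finset.inf_le hQF)) le_sup_left
  · simp only [Submodule.mem_finsetInf, Finset.mem_image, forall_exists_index, and_imp,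
      forall_apply_eq_imp_iff₂, id] at hx
    have hxF : x ∈ F.inf id := (Submodule.mem_finsetInf ..).2 fun Q hQ => (hx Q hQ).1
    obtain ⟨Q, hQ⟩ : F.Nonempty := by
      by_contra hne
      rw [Finset.not_nonempty_iff_eq_empty] at hne
      subst hne
      refine Set.disjoint_left.1 hI ?_ hv
      simpa using hvF 1 (by simp)
    obtain ⟨i, hi, z, hz, rfl⟩ := Submodule.mem_sup.1 (hx Q hQ).2
    obtain ⟨y, rfl⟩ := Ideal.mem_span_singleton.1 hz
    refine I.add_mem hi (hvF y (hsat y ?_))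
    simpa using (F.inf id).sub_mem hxF (hIF hi)

theorem isStronglySPrimary_component {S : Subsemigroup R} {s : R} (hs : s ∈ S) {I P : Ideal R}
    [P.IsPrime] (hP : P ∈ I.minimalPrimes) (hPS : Disjoint (P : Set R) (S : Set R)) {N : ℕ}
    (hN : P ^ N ≤ component I P) : IsStronglySPrimary S (component I P) := by
  refine ⟨⟨hPS.mono_left (component_le hP.1.2), s, hs, fun a b hab => ?_⟩,
    N + 1, N.succ_pos, s, hs, ?_⟩
  · rw [radical_component hP]
    by_cases hb : b ∈ P
    · exact Or.inr (P.mul_mem_left _ hb)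
    · exact Or.inl (Ideal.mul_mem_left _ _ (mem_component_of_mul_mem hb (by rwa [mul_comm])))
  · rw [radical_component hP]
    exact Ideal.mul_le_right.trans ((Ideal.pow_le_pow_right N.le_succ).trans hN)

theorem IsElementwiseLocallyDivided.isStronglySLaskerian (hR : IsElementwiseLocallyDivided R)
    {S : Subsemigroup R} (h : ∀ I : Ideal R, Disjoint (I : Set R) (S : Set R) →
      ∃ n, IsSAbsorbing S (n + 1) I) : IsStronglySLaskerian R S := by
  classical
  intro I hI
  obtain ⟨n, -, s, hs, hn⟩ := h I hI
  obtain ⟨v, hv, T, hT, hvT⟩ := hR.exists_components hs hn hI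
  have hprime : ∀ P : T, P.1.IsPrime := fun P => (hT P P.2).1.1.1
  set F := T.attach.image fun P => component I P.1 with hFdef
  have hmem : ∀ x, x ∈ F.inf id ↔ ∀ P : T, x ∈ component I P.1 := fun x => by
    simp [hFdef, Submodule.mem_finsetInf]
  refine exists_eq_inf_of_mul_mem hI hv (F := F) ?_ ?_ ?_ ?_
  · intro Q hQ
    obtain ⟨P, -, rfl⟩ := Finset.mem_image.1 hQ
    obtain ⟨N, hN⟩ := AbsorbsWith.exists_pow_le_component hn
      (Set.disjoint_right.1 (hT P P.2).2 hs) (hT P P.2).1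
    exact isStronglySPrimary_component hs (hT P P.2).1 (hT P P.2).2 hN
  · exact fun x hx => (hmem x).2 fun P => le_component I P.1 hx
  · exact fun x hx => hvT x fun P hP _ => (hmem x).1 hx ⟨P, hP⟩
  · exact fun x hx => (hmem x).2 fun P => mem_component_of_mul_mem
      (Set.disjoint_right.1 (hT P P.2).2 hv) ((hmem _).1 hx P)

/-! ### From `S`-Noetherian to strongly `S`-Laskerian -/

theorem exists_mul_mem_of_fg {S : Subsemigroup R} (hS : (S : Set R).Nonempty) {I J : Ideal R}
    (hJ : J.FG) (h : ∀ x ∈ J, ∃ u ∈ S, u * x ∈ I) : ∃ u ∈ S, ∀ x ∈ J, u * x ∈ I := by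
  obtain ⟨G, rfl⟩ := hJ
  obtain ⟨s, hs⟩ := hS
  have h' : ∀ x, ∃ u ∈ S, x ∈ G → u * x ∈ I := fun x => by
    by_cases hx : x ∈ G
    · obtain ⟨u, hu, hux⟩ := h x (Ideal.subset_span hx)
      exact ⟨u, hu, fun _ => hux⟩
    · exact ⟨s, hs, fun h => absurd h hx⟩
  choose u hu hux using h'
  refine ⟨s * ∏ x ∈ G, u x, mul_prod_mem hs G fun x _ => hu x, fun x hx => ?_⟩
  have : Ideal.span (G : Set R) ≤ I.colon {s * ∏ x ∈ G, u x} := by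
    rw [Ideal.span_le]
    intro y hy
    rw [SetLike.mem_coe, Submodule.mem_colon_singleton, smul_eq_mul, mul_comm]
    exact Ideal.mem_of_dvd _
      (mul_dvd_mul_right ((Finset.dvd_prod_of_mem u hy).mul_left s) y) (hux y hy)
  have := this hx
  rwa [Submodule.mem_colon_singleton, smul_eq_mul, mul_comm] at this

theorem eq_one_or_mem_of_mem_closure {S : Subsemigroup R} {x : R}
    (hx : x ∈ Submonoid.closure (S : Set R)) : x = 1 ∨ x ∈ S := by
  induction hx using Submonoid.closure_induction with
  | mem x hx => exact Or.inr hx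
  | one => exact Or.inl rfl
  | mul x y _ _ hx hy =>
    rcases hx with rfl | hx
    · simpa using hy
    · rcases hy with rfl | hy
      · simpa using Or.inr hx
      · exact Or.inr (mul_mem hx hy)

theorem IsSNoetherian.isNoetherianRing_localization {S : Subsemigroup R}
    (h : IsSNoetherian R S) :
    IsNoetherianRing (Localization (Submonoid.closure (S : Set R))) := by
  rw [isNoetherianRing_iff_ideal_fg]
  intro J
  set A := Localization (Submonoid.closure (S : Set R))
  obtain ⟨s, hs, J₀, hfg, hle, hle'⟩ := h (J.comap (algebraMap R A))
  have : J = J₀.map (algebraMap R A) := by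
    apply le_antisymm
    · rw [← IsLocalization.map_under (Submonoid.closure (S : Set R)) A J, Ideal.map_le_iff_le_comap]
      intro x hx
      have h1 := Ideal.mem_map_of_mem (algebraMap R A)
        (hle (Ideal.mul_mem_mul (Ideal.mem_span_singleton_self s) hx))
      rw [map_mul] at h1
      exact (Ideal.unit_mul_mem_iff_mem _ (IsLocalization.map_units A
        (⟨s, Submonoid.subset_closure hs⟩ : Submonoid.closure (S : Set R)))).1 h1
    · exact Ideal.map_le_iff_le_comap.2 hle'
  rw [this]
  exact hfg.map _

theorem isStronglySPrimary_comap {S : Subsemigroup R} {s : R} (hs : s ∈ S) {A : Type*} [CommRing A]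
    [IsNoetherianRing A] (f : R →+* A) (hf : ∀ u ∈ S, IsUnit (f u)) {q : Ideal A}
    (hq : q.IsPrimary) : IsStronglySPrimary S (q.comap f) := by
  rw [Ideal.isPrimary_iff] at hq
  refine ⟨⟨Set.disjoint_left.2 fun u hu huS => hq.1 (Ideal.eq_top_of_isUnit_mem _ hu (hf u huS)),
    s, hs, fun a b hab => ?_⟩, ?_⟩
  · rw [Ideal.mem_comap, map_mul] at hab
    rw [← Ideal.comap_radical]
    rcases hq.2 hab with h | h
    · exact Or.inl (Ideal.mul_mem_left _ _ h)
    · exact Or.inr (Ideal.mul_mem_left _ _ h)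
  · obtain ⟨n, hn⟩ := q.exists_radical_pow_le_of_fg (IsNoetherian.noetherian _)
    refine ⟨n + 1, n.succ_pos, s, hs, Ideal.mul_le_right.trans ?_⟩
    rw [← Ideal.comap_radical]
    exact (Ideal.le_comap_pow f _).trans
      (Ideal.comap_mono ((Ideal.pow_le_pow_right n.le_succ).trans hn))

theorem IsSNoetherian.isStronglySLaskerian {S : Subsemigroup R} (hS : (S : Set R).Nonempty)
    (h : IsSNoetherian R S) : IsStronglySLaskerian R S := by
  classical
  intro I hI
  have hN := h.isNoetherianRing_localization
  set T := Submonoid.closure (S : Set R)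
  set f := algebraMap R (Localization T)
  obtain ⟨s, hs⟩ := hS
  obtain ⟨𝓕, hinf, h𝓕⟩ := Submodule.isLasker (Localization T) (Localization T) (I.map f)
  have hmem : ∀ x, x ∈ (𝓕.image (Ideal.comap f)).inf id ↔ f x ∈ I.map f := fun x => by
    rw [← hinf]
    simp [Submodule.mem_finsetInf]
  have hmem' : ∀ x, f x ∈ I.map f ↔ ∃ u ∈ S, u * x ∈ I := fun x => by
    rw [IsLocalization.algebraMap_mem_map_algebraMap_iff T]
    constructor
    · rintro ⟨m, hm, hmx⟩
      rcases eq_one_or_mem_of_mem_closure hm with rfl | hm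
      · exact ⟨s, hs, I.mul_mem_left _ (by simpa using hmx)⟩
      · exact ⟨m, hm, hmx⟩
    · rintro ⟨u, hu, hux⟩
      exact ⟨u, Submonoid.subset_closure hu, hux⟩
  obtain ⟨t, ht, J, hJ, hle, hle'⟩ := h ((𝓕.image (Ideal.comap f)).inf id)
  obtain ⟨u, hu, huJ⟩ := exists_mul_mem_of_fg ⟨s, hs⟩ hJ
    fun x hx => (hmem' x).1 ((hmem x).1 (hle' hx))
  refine exists_eq_inf_of_mul_mem hI (mul_mem hu ht) (F := 𝓕.image (Ideal.comap f)) ?_ ?_ ?_ ?_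
  · intro Q hQ
    obtain ⟨q, hq, rfl⟩ := Finset.mem_image.1 hQ
    exact isStronglySPrimary_comap hs f (fun v hv => IsLocalization.map_units (Localization T)
      (⟨v, Submonoid.subset_closure hv⟩ : T)) (h𝓕 hq)
  · exact fun x hx => (hmem x).2 (Ideal.mem_map_of_mem f hx)
  · intro x hx
    rw [mul_assoc]
    exact huJ _ (hle (Ideal.mul_mem_mul (Ideal.mem_span_singleton_self t) hx))
  · intro x hx
    rw [hmem, hmem'] at hx ⊢
    obtain ⟨w, hw, hwx⟩ := hx
    exact ⟨w * (u * t), mul_mem hw (mul_mem hu ht), by rwa [mul_assoc]⟩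

/-! ### Arithmetical rings and `S`-finiteness of primes -/

theorem IsArithmetical.exists_mul_mem_span (hR : IsArithmetical R) (a b : R) :
    ∃ u, u * b ∈ Ideal.span {a} ∧ (1 - u) * a ∈ Ideal.span {b} := by
  -- Distributivity is applied to a = b + (a − b).
  have ha : a ∈ (Ideal.span {b} ⊔ Ideal.span {a - b}) ⊓ Ideal.span {a} := by
    refine ⟨?_, Ideal.mem_span_singleton_self a⟩
    have := Ideal.add_mem _ (Ideal.mem_sup_left (Ideal.mem_span_singleton_self b))
      (Ideal.mem_sup_right (Ideal.mem_span_singleton_self (a - b)))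
    rwa [add_sub_cancel] at this
  rw [hR] at ha
  obtain ⟨y, hy, z, hz, hyz⟩ := Submodule.mem_sup.1 ha
  obtain ⟨u, rfl⟩ := Ideal.mem_span_singleton.1 hz.1
  obtain ⟨r, hr⟩ := Ideal.mem_span_singleton.1 hz.2
  obtain ⟨t, rfl⟩ := Ideal.mem_span_singleton.1 hy.1
  refine ⟨u, Ideal.mem_span_singleton.2 ⟨u - r, ?_⟩, Ideal.mem_span_singleton.2 ⟨t - u, ?_⟩⟩
  · linear_combination -hr
  · linear_combination -hyz

theorem IsArithmetical.isElementwiseLocallyDivided (hR : IsArithmetical R) :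
    IsElementwiseLocallyDivided R := by
  intro M hM P hP hPM a ha p hp
  obtain ⟨u, h1, h2⟩ := hR.exists_mul_mem_span a p
  by_cases hu : u ∈ M
  · refine absurd (P.span_singleton_le_iff_mem.2 hp h2) fun h => ?_
    rcases hP.mem_or_mem h with h | h
    · exact hM.ne_top ((Ideal.eq_top_iff_one M).2 (by simpa using M.add_mem (hPM h) hu))
    · exact ha h
  · obtain ⟨r, hr⟩ := Ideal.mem_span_singleton.1 h1
    exact ⟨u, hu, r, hr⟩

/-- This is what makes Cohen's theorem available: an Oka family is controlled by its prime members.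
-/
theorem isOka_isSFinite {S : Subsemigroup R} (hS : (S : Set R).Nonempty) :
    Ideal.IsOka (IsSFinite S) where
  top := by
    obtain ⟨s, hs⟩ := hS
    exact ⟨s, hs, ⊤, ⟨{1}, by simp⟩, le_top, le_rfl⟩
  oka {I a} := by
    classical
    rintro ⟨s, hs, _, ⟨G, rfl⟩, h1, h2⟩ ⟨t, ht, J, hJ, h3, h4⟩
    have hG : ∀ g, ∃ i ∈ I, g ∈ G → g - i ∈ Ideal.span {a} := fun g => by
      by_cases hg : g ∈ G
      · obtain ⟨i, hi, z, hz, hiz⟩ := Submodule.mem_sup.1 (h2 (Ideal.subset_span hg))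
        exact ⟨i, hi, fun _ => by rw [← hiz]; simpa using hz⟩
      · exact ⟨0, I.zero_mem, fun h => absurd h hg⟩
    choose i hi hiG using hG
    have hIle : Ideal.span (G.image i : Set R) ≤ I := by
      rw [Ideal.span_le]
      intro x hx
      obtain ⟨g, -, rfl⟩ := Finset.mem_image.1 (Finset.mem_coe.1 hx)
      exact hi g
    have haJ : Ideal.span {a} * J ≤ I := by
      rw [Ideal.span_singleton_mul_le_iff]
      intro z hz
      simpa [mul_comm] using Ideal.mem_colon_span_singleton.1 (h4 hz)
    refine ⟨t * s, mul_mem ht hs, Ideal.span (G.image i : Set R) ⊔ Ideal.span {a} * J,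
      Submodule.FG.sup ⟨G.image i, rfl⟩ (Ideal.FG.mul ⟨{a}, by simp⟩ hJ), ?_, sup_le hIle haJ⟩
    rw [Ideal.span_singleton_mul_le_iff]
    intro x hx
    have hGle : Ideal.span (G : Set R) ≤ Ideal.span (G.image i : Set R) ⊔ Ideal.span {a} := by
      rw [Ideal.span_le]
      intro g hg
      have h5 : i g ∈ Ideal.span (G.image i : Set R) :=
        Ideal.subset_span (Finset.mem_coe.2 (Finset.mem_image_of_mem i hg))
      have := Ideal.add_mem _ (Ideal.mem_sup_left h5) (Ideal.mem_sup_right (hiG g hg))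
      simpa using this
    have hsx := hGle (h1 (Ideal.mul_mem_mul (Ideal.mem_span_singleton_self s)
      (Ideal.mem_sup_left hx)))
    obtain ⟨y, hy, z, hz, hyz⟩ := Submodule.mem_sup.1 hsx
    obtain ⟨r, rfl⟩ := Ideal.mem_span_singleton.1 hz
    have hr : r ∈ I.colon (Ideal.span {a}) := by
      rw [Ideal.mem_colon_span_singleton]
      convert I.sub_mem (I.mul_mem_left s hx) (hIle hy) using 1
      linear_combination hyz
    have htr := h3 (Ideal.mul_mem_mul (Ideal.mem_span_singleton_self t) hr)
    have := Ideal.add_mem _ (Ideal.mem_sup_left (Ideal.mul_mem_left _ t hy))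
      (Ideal.mem_sup_right (Ideal.mul_mem_mul (Ideal.mem_span_singleton_self a) htr))
    convert this using 1
    linear_combination -t * hyz

theorem isSNoetherian_of_prime {S : Subsemigroup R} (hS : (S : Set R).Nonempty)
    (h : ∀ P : Ideal R, P.IsPrime → Disjoint (P : Set R) (S : Set R) → IsSFinite S P) :
    IsSNoetherian R S := by
  refine (isOka_isSFinite hS).forall_of_forall_prime' (fun C _ hC I hI hfin => ?_) fun P hP => ?_
  · obtain ⟨s, hs, _, ⟨G, rfl⟩, h1, h2⟩ := hfin
    obtain ⟨J, hJ, hGJ⟩ : ∃ J ∈ C, (G : Set R) ⊆ J := by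
      refine hC.directedOn.exists_mem_subset_of_finset_subset_biUnion ⟨I, hI⟩ fun _ hx => ?_
      simp only [Set.mem_iUnion, SetLike.mem_coe, exists_prop]
      exact (Submodule.mem_sSup_of_directed ⟨I, hI⟩ hC.directedOn).1 (h2 (Ideal.subset_span hx))
    exact ⟨J, hJ, s, hs, _, ⟨G, rfl⟩, (Ideal.mul_mono_right (le_sSup hJ)).trans h1,
      Ideal.span_le.2 hGJ⟩
  · by_cases hPS : Disjoint (P : Set R) (S : Set R)
    · exact h P hP hPS
    · obtain ⟨u, hu, huS⟩ := Set.not_disjoint_iff.1 hPS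
      exact ⟨u, huS, Ideal.span {u}, ⟨{u}, by simp⟩, Ideal.mul_le_left,
        P.span_singleton_le_iff_mem.2 hu⟩

theorem IsArithmetical.exists_mem_minimalPrimes_span (hR : IsArithmetical R) {S : Subsemigroup R}
    (h : ∀ I : Ideal R, Disjoint (I : Set R) (S : Set R) → ∃ n, IsSAbsorbing S (n + 1) I)
    {P : Ideal R} (hP : P.IsPrime) (hPS : Disjoint (P : Set R) (S : Set R)) :
    ∃ x ∈ P, P ∈ (Ideal.span {x}).minimalPrimes := by
  by_cases hmin : ∀ Q : Ideal R, Q.IsPrime → Q ≤ P → P ≤ Q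
  · exact ⟨0, P.zero_mem, ⟨hP, by simp⟩, fun Q hQ hle => hmin Q hQ.1 hle⟩
  push Not at hmin
  obtain ⟨P₀, hP₀, hP₀P, hle⟩ := hmin
  obtain ⟨x, hx, hxP₀⟩ := SetLike.not_le_iff_exists.1 hle
  refine ⟨x, hx, ⟨hP, by simpa [Ideal.span_le] using hx⟩, fun Q hQ hQP a ha => ?_⟩
  by_contra haQ
  have hQp := hQ.1
  have hxQ : x ∈ Q := hQ.2 (Ideal.mem_span_singleton_self x)
  have hxa : Ideal.span {x * a} ≤ Q := by
    rw [Ideal.span_singleton_le_iff_mem]; exact Q.mul_mem_right _ hxQ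
  -- Absorption for (xa) puts x in (xa) up to a factor outside P. As x is outside the smaller prime
  -- `P₀`, it can be cancelled modulo `P₀`, which contradicts a ∈ P.
  obtain ⟨n, -, s, hs, hn⟩ := h (Ideal.span {x * a}) (hPS.mono_left (hxa.trans hQP))
  have hsP : s ∉ P := Set.disjoint_right.1 hPS hs
  obtain ⟨M, hM, hPM⟩ := Ideal.exists_le_maximal P hP.ne_top
  obtain ⟨d, hd, hdx⟩ := hR.isElementwiseLocallyDivided.exists_mul_mem hn hQp hxa
    (fun h => hsP (hQP h)) hM (hQP.trans hPM) haQ (x := x)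
    (by rw [mul_comm]; exact Ideal.mem_span_singleton_self _)
  obtain ⟨t, ht⟩ := Ideal.mem_span_singleton.1 hdx
  have h1 : x * (s * d - a * t) ∈ P₀ := by
    convert P₀.zero_mem using 1
    linear_combination ht
  have h2 : s * d ∈ P := by
    simpa using P.add_mem (hP₀P ((hP₀.mem_or_mem h1).resolve_left hxP₀)) (P.mul_mem_right t ha)
  exact (hP.mem_or_mem h2).elim hsP fun h => hd (hPM h)

/-- Locally at P the ideals form a chain. If P were not locally principal, each y ∈ P would be a
proper multiple of some z ∈ P, so P would locally equal all its powers; but a power of P lies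
locally in (x). -/
theorem IsArithmetical.exists_le_component_span (hR : IsArithmetical R) {S : Subsemigroup R}
    (h : ∀ I : Ideal R, Disjoint (I : Set R) (S : Set R) → ∃ n, IsSAbsorbing S (n + 1) I)
    {P : Ideal R} [hP : P.IsPrime] (hPS : Disjoint (P : Set R) (S : Set R)) :
    ∃ x ∈ P, P ≤ component (Ideal.span {x}) P := by
  by_contra! hcon
  obtain ⟨x, hx, hmin⟩ := hR.exists_mem_minimalPrimes_span h hP hPS
  obtain ⟨n, -, s, hs, hn⟩ := h (Ideal.span {x}) (hPS.mono_left hmin.1.2)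
  obtain ⟨N, hN⟩ := AbsorbsWith.exists_pow_le_component hn (Set.disjoint_right.1 hPS hs) hmin
  have key : ∀ k, ∀ y ∈ P, ∃ c ∉ P, c * y ∈ P ^ (k + 1) := by
    intro k
    induction k with
    | zero => exact fun y hy => ⟨1, P.ne_top_iff_one.1 hP.ne_top, by simpa using hy⟩
    | succ k ih =>
      intro y hy
      obtain ⟨z, hz, hzy⟩ := SetLike.not_le_iff_exists.1 (hcon y hy)
      rw [mem_component] at hzy
      push Not at hzy
      obtain ⟨u, hu, hu'⟩ := hR.exists_mul_mem_span y z
      have huP : u ∈ P := by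
        by_contra huP
        exact hzy u huP hu
      obtain ⟨r, hr⟩ := Ideal.mem_span_singleton.1 hu'
      have hrP : r ∈ P := by
        by_contra hrP
        refine hzy r hrP (Ideal.mem_span_singleton.2 ⟨1 - u, ?_⟩)
        linear_combination -hr
      obtain ⟨d, hd, hdz⟩ := ih z hz
      refine ⟨d * (1 - u), fun hdu => ?_, ?_⟩
      · refine (hP.mem_or_mem hdu).elim hd fun h => hP.ne_top ((Ideal.eq_top_iff_one P).2 ?_)
        simpa using P.add_mem h huP
      · rw [mul_assoc, hr, ← mul_assoc]
        exact Ideal.mul_mem_mul hdz hrP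
  refine hcon x hx fun y hy => ?_
  obtain ⟨c, hc, hcy⟩ := key N y hy
  exact mem_component_of_mul_mem hc (hN (Ideal.pow_le_pow_right N.le_succ hcy))

theorem IsElementwiseLocallyDivided.sup_eq_top_of_mem_minimalPrimes
    (hR : IsElementwiseLocallyDivided R) {I P Q : Ideal R} (hP : P ∈ I.minimalPrimes)
    (hQ : Q ∈ I.minimalPrimes) (hPQ : P ≠ Q) : P ⊔ Q = ⊤ := by
  by_contra hne
  obtain ⟨M, hM, hle⟩ := Ideal.exists_le_maximal _ hne
  obtain ⟨a, haQ, haP⟩ := SetLike.not_le_iff_exists.1 (show ¬ Q ≤ P from fun h =>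
    hPQ (le_antisymm (hP.2 hQ.1 h) h))
  have hle' : P ≤ Q := fun p hp => by
    obtain ⟨c, hc, r, hr⟩ := hR M hM P hP.1.1 (le_sup_left.trans hle) a haP p hp
    exact (hQ.1.1.mem_or_mem (hr ▸ Q.mul_mem_right r haQ)).resolve_left
      fun h => hc (hle (Ideal.mem_sup_right h))
  exact hPQ (le_antisymm hle' (hQ.2 hP.1 hle'))

theorem IsArithmetical.isSFinite_of_isPrime (hR : IsArithmetical R) {S : Subsemigroup R}
    (h : ∀ I : Ideal R, Disjoint (I : Set R) (S : Set R) → ∃ n, IsSAbsorbing S (n + 1) I)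
    {P : Ideal R} (hP : P.IsPrime) (hPS : Disjoint (P : Set R) (S : Set R)) : IsSFinite S P := by
  classical
  obtain ⟨x, hx, hxP⟩ := hR.exists_le_component_span h hPS
  have hmin : P ∈ (Ideal.span {x}).minimalPrimes := by
    refine ⟨⟨hP, P.span_singleton_le_iff_mem.2 hx⟩, fun Q hQ hQP y hy => ?_⟩
    obtain ⟨c, hc, hcy⟩ := hxP hy
    exact (hQ.1.mem_or_mem (hQ.2 hcy)).resolve_left fun h => hc (hQP h)
  obtain ⟨n, -, s, hs, hn⟩ := h (Ideal.span {x}) (hPS.mono_left hmin.1.2)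
  obtain ⟨v, hv, T, hT, hvT⟩ := hR.isElementwiseLocallyDivided.exists_components hs hn
    (hPS.mono_left hmin.1.2)
  -- For Q ≠ P, comaximality gives p + q = 1, so (1 − p)^N = q^N lies in the component at Q. Modulo
  -- x and the elements p, these multipliers become 1, leaving vP inside a finitely generated ideal.
  have hp : ∀ Q, ∃ p ∈ P, ∃ N : ℕ, Q ∈ T → ∀ _ : Q.IsPrime, ∀ y ∈ P,
      y * (1 - p) ^ N ∈ component (Ideal.span {x}) Q := by
    intro Q
    by_cases hQ : Q ∈ T
    · by_cases hQP : P = Q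
      · subst hQP
        exact ⟨0, P.zero_mem, 0, fun _ _ y hy => Ideal.mul_mem_right _ _ (hxP hy)⟩
      · have htop := hR.isElementwiseLocallyDivided.sup_eq_top_of_mem_minimalPrimes hmin
          (hT Q hQ).1 hQP
        obtain ⟨p, hp, q, hq, hpq⟩ := Submodule.mem_sup.1 ((Ideal.eq_top_iff_one _).1 htop)
        have hQp := (hT Q hQ).1.1.1
        obtain ⟨N, hN⟩ := AbsorbsWith.exists_pow_le_component hn
          (Set.disjoint_right.1 (hT Q hQ).2 hs) (hT Q hQ).1
        refine ⟨p, hp, N, fun _ _ y _ => Ideal.mul_mem_left _ _ (hN (Ideal.pow_mem_pow ?_ N))⟩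
        rwa [← hpq, add_sub_cancel_left]
    · exact ⟨0, P.zero_mem, 0, fun h => absurd h hQ⟩
  choose p hpP N hpN using hp
  refine ⟨v, hv, Ideal.span (insert x (T.image p) : Finset R), ⟨_, rfl⟩, ?_, ?_⟩
  · rw [Ideal.span_singleton_mul_le_iff]
    intro y hy
    have h1 : v * (y * ∏ Q ∈ T, (1 - p Q) ^ N Q) ∈ Ideal.span {x} := hvT _ fun Q hQ hQp =>
      Ideal.mem_of_dvd _ (mul_dvd_mul_left y
        (Finset.dvd_prod_of_mem (fun Q => (1 - p Q) ^ N Q) hQ)) (hpN Q hQ hQp y hy)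
    have h2 := Ideal.span_mono (show ({x} : Set R) ⊆ (insert x (T.image p) : Finset R) by simp) h1
    rw [← Ideal.Quotient.eq_zero_iff_mem] at h2 ⊢
    simp only [map_mul, map_prod, map_pow, map_sub, map_one] at h2
    rw [Finset.prod_eq_one fun Q hQ => ?_, mul_one] at h2
    · rw [map_mul, h2]
    · rw [Ideal.Quotient.eq_zero_iff_mem.2 (Ideal.subset_span (by
        simp only [Finset.coe_insert, Finset.coe_image]
        exact Or.inr ⟨Q, hQ, rfl⟩)), sub_zero, one_pow]
  · rw [Ideal.span_le]
    intro y hy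
    rw [Finset.mem_coe, Finset.mem_insert, Finset.mem_image] at hy
    rcases hy with rfl | ⟨Q, -, rfl⟩
    · exact hx
    · exact hpP Q

end SAbsorbing

theorem mainTheorem3 {R : Type*} [CommRing R] (S : Subsemigroup R) (hS : (S : Set R).Nonempty) :
    ((SAbsorbing.IsStronglySLaskerian R S → SAbsorbing.Omega R S ⊆ SAbsorbing.posNat) ∧
      (SAbsorbing.IsLocallyDivided R →
        SAbsorbing.Omega R S ⊆ SAbsorbing.posNat → SAbsorbing.IsStronglySLaskerian R S)) ∧
    (SAbsorbing.IsArithmetical R →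
      [SAbsorbing.IsSNoetherian R S,
        SAbsorbing.IsStronglySLaskerian R S,
        SAbsorbing.Omega R S ⊆ SAbsorbing.posNat].TFAE) := by
  have h1 : SAbsorbing.IsStronglySLaskerian R S → SAbsorbing.Omega R S ⊆ SAbsorbing.posNat :=
    fun h => SAbsorbing.Omega_subset_posNat_iff.2 fun _ hI => h.exists_isSAbsorbing hS hI
  refine ⟨⟨h1, fun hR h => ?_⟩, fun hR => ?_⟩
  · exact hR.elementwise.isStronglySLaskerian (SAbsorbing.Omega_subset_posNat_iff.1 h)
  · tfae_have 1 → 2 := fun h => h.isStronglySLaskerian hS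
    tfae_have 2 → 3 := h1
    tfae_have 3 → 1 := fun h => SAbsorbing.isSNoetherian_of_prime hS fun _ hP hPS =>
      hR.isSFinite_of_isPrime (SAbsorbing.Omega_subset_posNat_iff.1 h) hP hPS
    tfae_finish
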